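/- An *abelian monoidal category* is a monoidal category $(\mathcal C,\otimes,\mathbb 1)$ whose underlying category is abelian and such that $X\otimes -$ and $-\otimes X$ are additive for every $X\in\mathcal C$. Let $A=(A,m_A,u_A)$ be a non-zero (associative, unital) algebra in an abelian monoidal category $\mathcal C$, and let $A\text{-}\mathsf{Mod}(\mathcal C)$ and $\mathsf{Mod}\text{-}A(\mathcal C)$ be the categories of left and right $A$-modules in $\mathcal C$. Call $A$ * *left (resp. right) monadic* if the monad $A\otimes -$ (resp. $-\otimes A$) on $\mathcal C$, with multiplication induced by $m_A$ and unit induced by $u_A$, is such that the comparison functor $Y\mapsto (T(Y),\mu_Y)$ from its Kleisli category to its Eilenberg–Moore category is an equivalence (here $T$ is the monad and $\mu$ its multiplication); * *left (resp. right) essential* if the free-module functor $A\otimes -:\mathcal C\to A\text{-}\mathsf{Mod}(\mathcal C)$ (resp. $-\otimes A:\mathcal C\to \mathsf{Mod}\text{-}A(\mathcal C)$) is essentially surjective; * *left (resp. right) simplistic* if the regular module $A$ is a simple object of $A\text{-}\mathsf{Mod}(\mathcal C)$ (resp. $\mathsf{Mod}\text{-}A(\mathcal C)$). Then: (i) $A$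 is left monadic if and only if it is left essential, and $A$ is right monadic if and only if it is right essential. (ii) Suppose that $\mathcal C$ is rigid and that $\mathbb 1$ is a simple object. If $A$ has a simple left module in $\mathcal C$ and is left essential, then $A$ is left simplistic. If $A$ has a simple right module in $\mathcal C$ and is right essential, then $A$ is right simplistic. (iii) Suppose that $\mathcal C$ is a pivotal multifusion category over an algebraically closed field $\Bbbk$ of characteristic zero; that is, $\mathcal C$ is a $\Bbbk$-linear abelian monoidal category ($\otimes$ being $\Bbbk$-linear in each variable) that is rigid and semisimple, in which all objects have finite length, all Hom-spaces are finite-dimensional, there are enough projectives and only finitely many isomorphism classes of simple objects, and there is a monoidal natural isomorphism $\mathrm{Id}_{\mathcal C}\cong (-)^{**}$. Then $A$ is left monadic if and only if it is right monadic, left essential if and only if it is right essential, and left simplistic if and only if it is right simplistic. -/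

import Mathlib

open CategoryTheory MonoidalCategory Limits

universe w v u

namespace DivAlg

noncomputable section

variable {C : Type u} [Category.{v} C] [MonoidalCategory C]

/-! ### Modules over an algebra

An algebra in `C` is an object `A` with Mathlib's `MonObj A`. The category of left `A`-modules in
`C` is Mathlib's `Mod C A`, for the action of `C` on itself by tensoring on the left. -/

/-- A right module in `C` over the algebra `A`. -/
structure RightMod (A : C) [MonObj A] where
  /-- The underlying object. -/
  X : C
  /-- The right action. -/
  act : X ⊗ A ⟶ X
  act_one : X ◁ MonObj.one (X := A) ≫ act = (ρ_ X).hom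
  act_mul : X ◁ MonObj.mul (X := A) ≫ act = (α_ X A A).inv ≫ act ▷ A ≫ act

namespace RightMod

variable {A : C} [MonObj A]

/-- A morphism of right modules. -/
@[ext]
structure Hom (M N : RightMod A) where
  /-- The underlying morphism. -/
  hom : M.X ⟶ N.X
  act_hom : M.act ≫ hom = hom ▷ A ≫ N.act

instance : Category (RightMod A) where
  Hom M N := Hom M N
  id M := ⟨𝟙 M.X, by simp⟩
  comp f g := ⟨f.hom ≫ g.hom, by
    rw [← Category.assoc, f.act_hom, Category.assoc, g.act_hom, comp_whiskerRight,
      Category.assoc]⟩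

@[ext]
lemma hom_ext {M N : RightMod A} (f g : M ⟶ N) (h : f.hom = g.hom) : f = g :=
  Hom.ext h

@[simp]
lemma id_hom (M : RightMod A) : (𝟙 M : M ⟶ M).hom = 𝟙 M.X := rfl

@[simp]
lemma comp_hom {M N K : RightMod A} (f : M ⟶ N) (g : N ⟶ K) :
    (f ≫ g).hom = f.hom ≫ g.hom := rfl

variable (A) in
/-- The regular right module. -/
def regular : RightMod A where
  X := A
  act := MonObj.mul
  act_one := MonObj.mul_one A
  act_mul := by simp [MonObj.mul_assoc]

end RightMod

section Free

variable (A : C) [MonObj A]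

/-- The free left module `A ⊗ X`. -/
def freeLeftObj (X : C) : Mod C A :=
  letI : ModObj A (A ⊗ X) :=
    { smul := (α_ A A X).inv ≫ MonObj.mul ▷ X
      one_smul := by
        change MonObj.one ▷ (A ⊗ X) ≫ (α_ A A X).inv ≫ MonObj.mul ▷ X = (λ_ (A ⊗ X)).hom
        rw [← Category.assoc, associator_inv_naturality_left, Category.assoc,
          ← comp_whiskerRight, MonObj.one_mul]
        simp
      mul_smul := by
        change MonObj.mul ▷ (A ⊗ X) ≫ (α_ A A X).inv ≫ MonObj.mul ▷ X =
          (α_ A A (A ⊗ X)).hom ≫ A ◁ ((α_ A A X).inv ≫ MonObj.mul ▷ X) ≫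
            (α_ A A X).inv ≫ MonObj.mul ▷ X
        rw [← Category.assoc, associator_inv_naturality_left, Category.assoc,
          ← comp_whiskerRight, MonObj.mul_assoc]
        simp }
  ⟨A ⊗ X⟩

/-- The free left module functor `A ⊗ - : C ⥤ A-Mod(C)`. -/
def freeLeft : C ⥤ Mod C A where
  obj X := freeLeftObj A X
  map {X Y} f := Mod.Hom.mk' (M := freeLeftObj A X) (N := freeLeftObj A Y) (A ◁ f) (by
    change ((α_ A A X).inv ≫ MonObj.mul ▷ X) ≫ A ◁ f =
      A ◁ (A ◁ f) ≫ (α_ A A Y).inv ≫ MonObj.mul ▷ Y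
    simp [← whisker_exchange])
  map_id X := by
    apply Mod.hom_ext
    exact whiskerLeft_id A X
  map_comp f g := by
    apply Mod.hom_ext
    exact whiskerLeft_comp A f g

/-- The free right module functor `- ⊗ A : C ⥤ Mod-A(C)`. -/
def freeRight : C ⥤ RightMod A where
  obj X :=
    { X := X ⊗ A
      act := (α_ X A A).hom ≫ X ◁ MonObj.mul
      act_one := by
        simp [← whiskerLeft_comp]
      act_mul := by
        simp [← whiskerLeft_comp, MonObj.mul_assoc] }
  map f := ⟨f ▷ A, by simp [whisker_exchange]⟩

/-! ### The two monads of an algebra -/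

/-- The monad `A ⊗ -` on `C`. -/
def leftMonad : Monad C where
  toFunctor := tensorLeft A
  η := { app := fun X => (λ_ X).inv ≫ MonObj.one ▷ X
         naturality := by
          intro X Y f
          simp [← whisker_exchange] }
  μ := { app := fun X => (α_ A A X).inv ≫ MonObj.mul ▷ X
         naturality := by
          intro X Y f
          simp [← whisker_exchange] }
  assoc := by
    intro X
    have h := congrArg (fun f => f ▷ X) (MonObj.mul_assoc A)
    simp only [comp_whiskerRight] at h
    simp [h]
  left_unit := by
    intro X
    have h := congrArg (fun f => f ▷ X) (MonObj.one_mul A)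
    simp only [comp_whiskerRight] at h
    simp [h]
  right_unit := by
    intro X
    have h := congrArg (fun f => f ▷ X) (MonObj.mul_one A)
    simp only [comp_whiskerRight] at h
    simp [associator_inv_naturality_middle_assoc, -whisker_assoc, h]

/-- The monad `- ⊗ A` on `C`. -/
def rightMonad : Monad C where
  toFunctor := tensorRight A
  η := { app := fun X => (ρ_ X).inv ≫ X ◁ MonObj.one
         naturality := by
          intro X Y f
          simp [whisker_exchange] }
  μ := { app := fun X => (α_ X A A).hom ≫ X ◁ MonObj.mul
         naturality := by
          intro X Y f
          simp [whisker_exchange] }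
  assoc := by
    intro X
    have h := congrArg (fun f => X ◁ f) (MonObj.mul_assoc A)
    simp only [whiskerLeft_comp] at h
    simp [h]
  left_unit := by
    intro X
    have h := congrArg (fun f => X ◁ f) (MonObj.mul_one A)
    simp only [whiskerLeft_comp] at h
    simp [h]
  right_unit := by
    intro X
    have h := congrArg (fun f => X ◁ f) (MonObj.one_mul A)
    simp only [whiskerLeft_comp] at h
    simp [h]

end Free

/-- The comparison functor from the Kleisli category to the Eilenberg–Moore category of a monad:
`Y ↦ (T Y, μ_Y)` and `f ↦ T f ≫ μ`. -/
def kleisliComparison {D : Type u} [Category.{v} D] (T : Monad D) : Kleisli T ⥤ T.Algebra where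
  obj Y := T.free.obj Y.of
  map {Y Z} f :=
    { f := T.map f.of ≫ T.μ.app Z.of
      h := by
        change T.map (T.map f.of ≫ T.μ.app Z.of) ≫ T.μ.app Z.of =
          T.μ.app Y.of ≫ T.map f.of ≫ T.μ.app Z.of
        rw [T.map_comp, Category.assoc, T.assoc, T.mu_naturality_assoc] }
  map_id Y := by
    ext
    exact T.right_unit Y.of
  map_comp {X Y Z} f g := by
    ext
    exact (Kleisli.Adjunction.fromKleisli T).map_comp f g

/-- A monad is adjunction-trivial if the comparison functor from its Kleisli category to its
Eilenberg–Moore category is an equivalence. -/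
def AdjunctionTrivial {D : Type u} [Category.{v} D] (T : Monad D) : Prop :=
  (kleisliComparison T).IsEquivalence

/-! ### Zero morphisms between modules -/

section Zero

variable [Preadditive C] [MonoidalPreadditive C] (A : C) [MonObj A]

instance : HasZeroMorphisms (Mod C A) where
  zero M N := ⟨Mod.Hom.mk' (M := M) (N := N) 0 (by
    change _ ≫ (0 : M.X ⟶ N.X) = A ◁ (0 : M.X ⟶ N.X) ≫ _
    simp)⟩
  comp_zero f N := by
    apply Mod.hom_ext
    exact comp_zero
  zero_comp M _ _ f := by
    apply Mod.hom_ext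
    exact zero_comp

instance : HasZeroMorphisms (RightMod A) where
  zero M N := ⟨⟨0, by simp⟩⟩
  comp_zero f N := by
    apply RightMod.hom_ext
    exact comp_zero
  zero_comp M _ _ f := by
    apply RightMod.hom_ext
    exact zero_comp

end Zero

/-! ### Division algebras -/

section DivisionAlgebras

variable (A : C) [MonObj A]

/-- Left monadic division algebra. -/
def IsLeftMonadic : Prop := ¬ IsZero A ∧ AdjunctionTrivial (leftMonad A)

/-- Right monadic division algebra. -/
def IsRightMonadic : Prop := ¬ IsZero A ∧ AdjunctionTrivial (rightMonad A)

/-- Left essential division algebra. -/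
def IsLeftEssential : Prop := ¬ IsZero A ∧ (freeLeft A).EssSurj

/-- Right essential division algebra. -/
def IsRightEssential : Prop := ¬ IsZero A ∧ (freeRight A).EssSurj

variable [Preadditive C] [MonoidalPreadditive C]

/-- Left simplistic division algebra. -/
def IsLeftSimplistic : Prop := ¬ IsZero A ∧ Simple (Mod.regular A)

/-- Right simplistic division algebra. -/
def IsRightSimplistic : Prop := ¬ IsZero A ∧ Simple (RightMod.regular A)

end DivisionAlgebras

/-! ### Pivotal categories

The dual `X*` with `ev : X* ⊗ X ⟶ 𝟙` and `coev : 𝟙 ⟶ X ⊗ X*` is called the right dual in Mathlib. -/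

section Pivotal

variable [RigidCategory C]

/-- The dual `X*` chosen by the rigid structure. -/
def dual (X : C) : C :=
  (RightRigidCategory.rightDual X).rightDual

/-- The pairing of `X` with `X*`. -/
@[reducible]
def dualPairing (X : C) : ExactPairing X (dual X) :=
  (RightRigidCategory.rightDual X).exact

/-- The dual `f* : Y* ⟶ X*` of a morphism `f : X ⟶ Y`. -/
def dualMap {X Y : C} (f : X ⟶ Y) : dual Y ⟶ dual X :=
  @rightAdjointMate C _ _ X Y (RightRigidCategory.rightDual X) (RightRigidCategory.rightDual Y) f

/-- The canonical isomorphism `(X ⊗ Y)* ≅ Y* ⊗ X*`. -/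
def dualTensorIso (X Y : C) : dual (X ⊗ Y) ≅ dual Y ⊗ dual X :=
  letI := dualPairing X
  letI := dualPairing Y
  rightDualIso (dualPairing (X ⊗ Y)) ExactPairing.tensor

variable (C) in
/-- The canonical isomorphism `𝟙* ≅ 𝟙`. -/
def dualUnitIso : dual (𝟙_ C) ≅ 𝟙_ C :=
  rightDualIso (dualPairing (𝟙_ C)) exactPairingUnit

/-- The tensor structure `X** ⊗ Y** ⟶ (X ⊗ Y)**` of the double dual functor. -/
def doubleDualTensor (X Y : C) : dual (dual X) ⊗ dual (dual Y) ⟶ dual (dual (X ⊗ Y)) :=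
  (dualTensorIso (dual Y) (dual X)).inv ≫ dualMap (dualTensorIso X Y).hom

variable (C) in
/-- The unit structure `𝟙 ⟶ 𝟙**` of the double dual functor. -/
def doubleDualUnit : 𝟙_ C ⟶ dual (dual (𝟙_ C)) :=
  (dualUnitIso C).inv ≫ dualMap (dualUnitIso C).hom

variable (C) in
/-- A pivotal structure: a monoidal natural isomorphism `X ≅ X**`. -/
structure PivotalStructure where
  /-- The components of the isomorphism. -/
  iso (X : C) : X ≅ dual (dual X)
  naturality {X Y : C} (f : X ⟶ Y) : f ≫ (iso Y).hom = (iso X).hom ≫ dualMap (dualMap f)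
  tensor (X Y : C) :
    (iso (X ⊗ Y)).hom = ((iso X).hom ⊗ₘ (iso Y).hom) ≫ doubleDualTensor X Y
  unit : (iso (𝟙_ C)).hom = doubleDualUnit C

end Pivotal

/-! ### Multifusion categories -/

/-- A `k`-linear abelian category is finite if all objects have finite length, all Hom-spaces are
finite-dimensional, there are enough projectives, and there are finitely many isomorphism classes
of simple objects. -/
structure IsFiniteLinear (k : Type w) [Field k] (D : Type u) [Category.{v} D] [Abelian D]
    [Linear k D] : Prop where
  finite_length (X : D) : IsArtinianObject X ∧ IsNoetherianObject X
  finite_hom (X Y : D) : FiniteDimensional k (X ⟶ Y)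
  enough_projectives : EnoughProjectives D
  finite_simples : ∃ (n : ℕ) (S : Fin n → D),
    ∀ X : D, Simple X → ∃ i, Nonempty (X ≅ S i)

/-- An abelian category is semisimple if every object is a finite direct sum of simple objects. -/
def IsSemisimple (D : Type u) [Category.{v} D] [Abelian D] : Prop :=
  ∀ X : D, ∃ (n : ℕ) (S : Fin n → D) (b : Bicone S),
    (∀ i, Simple (S i)) ∧ Nonempty b.IsBilimit ∧ Nonempty (X ≅ b.pt)

/-- A rigid `k`-linear abelian monoidal category is multifusion if it is finite and semisimple. -/
structure IsMultifusion (k : Type w) [Field k] (D : Type u) [Category.{v} D] [Abelian D]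
    [MonoidalCategory D] [MonoidalPreadditive D] [Linear k D] [MonoidalLinear k D]
    [RigidCategory D] : Prop where
  finite : IsFiniteLinear k D
  semisimple : IsSemisimple D

end

end DivAlg

/-!
The comparison functor of a monad is always fully faithful, so it is an equivalence exactly when
free algebras exhaust the Eilenberg–Moore category, and the algebras over `A ⊗ -` are the left
`A`-modules.

If `A` is left essential, a simple left module is of the form `A ⊗ X` with `X ≠ 0`. Since `𝟙` is
simple, the coevaluation of `X` is a monomorphism; hence `- ⊗ X` is faithful on modules. It also
preserves monomorphisms and reflects isomorphisms, so simplicity of `A ⊗ X` forces that of `A`.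

Passing from left to right rests on a form `φ : A ⟶ 𝟙` whose kernel contains no nonzero left ideal.
If `A` is left simplistic, any retraction of the unit is such a form. If `A` is left essential,
every left ideal is a direct summand, hence of the form `A e` with `e` idempotent; the form `φ`
with `tr (u ≫ φ) = tr (a ↦ a u)` then works, because in characteristic zero an idempotent of trace
zero vanishes. The transpose `A ⟶ A*` of `φ ∘ m` is a monomorphism by the choice of `φ`; its
transpose on the other side is an epimorphism between the same objects, because left and right
duals agree, and comparing dimensions of Hom-spaces makes both isomorphisms. So `φ` is a Frobenius
form, under which duality exchanges left and right modules, free modules with free modules, and the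
regular modules with each other. The converse implications follow by reversing the tensor product.
-/

namespace DivAlg

/-! ### Semisimple linear categories -/

section Semisimple

variable {D : Type u} [Category.{v} D] [Abelian D]

lemma IsSemisimple.isSplitEpi_of_simple (h : IsSemisimple D) {E S : D} [Simple S] (f : E ⟶ S)
    [Epi f] : IsSplitEpi f := by
  obtain ⟨n, T, b, hT, ⟨hb⟩, ⟨e⟩⟩ := h E
  have hf : f ≠ 0 := fun h0 => Simple.not_isZero S (IsZero.of_epi_eq_zero f h0)
  obtain ⟨j, hj⟩ : ∃ j, b.ι j ≫ e.inv ≫ f ≠ 0 := by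
    by_contra! hc
    apply hf
    rw [← cancel_epi e.inv, comp_zero]
    exact hb.isColimit.hom_ext fun ⟨j⟩ => by simpa using hc j
  have := hT j
  have := isIso_of_hom_simple hj
  exact ⟨⟨inv (b.ι j ≫ e.inv ≫ f) ≫ b.ι j ≫ e.inv, by simp⟩⟩

lemma IsSemisimple.projective_of_simple (h : IsSemisimple D) (S : D) [Simple S] :
    Projective S where
  factors g f _ :=
    have := h.isSplitEpi_of_simple (pullback.fst g f)
    ⟨section_ (pullback.fst g f) ≫ pullback.snd g f, by simp [← pullback.condition]⟩

lemma IsSemisimple.projective (h : IsSemisimple D) (X : D) : Projective X := by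
  obtain ⟨n, T, b, hT, ⟨hb⟩, ⟨e⟩⟩ := h X
  have (j : Fin n) : Projective (T j) := have := hT j; h.projective_of_simple (T j)
  refine Projective.of_iso e.symm ⟨fun {E Y} g f _ => ?_⟩
  let d : b.pt ⟶ E := hb.isColimit.desc (Cofan.mk E fun j => Projective.factorThru (b.ι j ≫ g) f)
  have hd (j : Fin n) : b.ι j ≫ d = Projective.factorThru (b.ι j ≫ g) f :=
    hb.isColimit.fac _ ⟨j⟩
  exact ⟨d, hb.isColimit.hom_ext fun ⟨j⟩ => by simp [reassoc_of% hd]⟩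

lemma isSplitMono_of_projective_cokernel {X Y : D} (f : X ⟶ Y) [Mono f]
    [Projective (cokernel f)] : IsSplitMono f :=
  have hS : (ShortComplex.mk f (cokernel.π f) (cokernel.condition f)).ShortExact :=
    { exact := ShortComplex.exact_cokernel f
      mono_f := ‹_›
      epi_g := inferInstance }
  hS.splittingOfProjective.isSplitMono_f

lemma exists_comp_comp_eq_self [∀ X : D, Projective X] {X Y : D} (f : X ⟶ Y) :
    ∃ g : Y ⟶ X, f ≫ g ≫ f = f := by
  obtain ⟨I, p, m, _, _, rfl⟩ : ∃ (I : D) (p : X ⟶ I) (m : I ⟶ Y), Epi p ∧ Mono m ∧ p ≫ m = f :=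
    ⟨_, _, _, inferInstance, inferInstance, Abelian.image.fac f⟩
  have := isSplitMono_of_projective_cokernel m
  exact ⟨retraction m ≫ Projective.factorThru (𝟙 I) p, by simp⟩

end Semisimple

section Linear

variable {k : Type w} [Field k] {D : Type u} [Category.{v} D] [Preadditive D] [Linear k D]

lemma isIso_of_mono_of_epi_of_projective {X Y : D} [FiniteDimensional k (Y ⟶ X)]
    [FiniteDimensional k (Y ⟶ Y)] [Projective Y] (g f : X ⟶ Y) [Mono g] [Epi f] : IsIso g := by
  have hg : Function.Injective (Linear.rightComp k Y g) := fun _ _ h => (cancel_mono g).1 h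
  have hf : Function.Surjective (Linear.rightComp k Y f) := fun h =>
    ⟨Projective.factorThru h f, Projective.factorThru_comp _ _⟩
  have hdim : Module.finrank k (Y ⟶ X) = Module.finrank k (Y ⟶ Y) :=
    le_antisymm (LinearMap.finrank_le_finrank_of_injective hg)
      (LinearMap.finrank_le_finrank_of_surjective hf)
  obtain ⟨s, hs⟩ := (LinearMap.injective_iff_surjective_of_finrank_eq_finrank hdim).1 hg (𝟙 Y)
  have : IsSplitEpi g := ⟨⟨s, hs⟩⟩
  exact isIso_of_mono_of_isSplitEpi g

variable (k) in
/-- The trace of the endomorphism `v ↦ v ≫ e` of `Z ⟶ X`, as a linear form in `e`. -/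
noncomputable def compTrace (Z X : D) : (X ⟶ X) →ₗ[k] k :=
  LinearMap.trace k (Z ⟶ X) ∘ₗ (Linear.comp Z X X).flip

lemma comp_eq_zero_of_compTrace_eq_zero [CharZero k] {Z X : D} [FiniteDimensional k (Z ⟶ X)]
    {e : X ⟶ X} (he : e ≫ e = e) (h : compTrace k Z X e = 0) (v : Z ⟶ X) : v ≫ e = 0 := by
  have hi : IsIdempotentElem (show Module.End k (Z ⟶ X) from Linear.rightComp k Z e) := by
    ext v
    simp [he]
  exact LinearMap.congr_fun (LinearMap.IsIdempotentElem.eq_zero_of_trace_eq_zero hi h) v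

variable (k) in
/-- The pairing `(u, f) ↦ tr (u ≫ f)` between `X ⟶ Y` and `Y ⟶ X`, for the trace on
`X ⟶ X` given by `compTrace`. -/
noncomputable def tracePairing (X Y : D) : (Y ⟶ X) →ₗ[k] Module.Dual k (X ⟶ Y) :=
  LinearMap.llcomp k _ _ _ (compTrace k X X) ∘ₗ (Linear.comp X Y X).flip

lemma tracePairing_apply (X Y : D) (f : Y ⟶ X) (u : X ⟶ Y) :
    tracePairing k X Y f u = compTrace k X X (u ≫ f) := rfl

end Linear

section Perfect

variable {k : Type w} [Field k] [CharZero k] {D : Type u} [Category.{v} D] [Abelian D]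
  [Linear k D] [∀ X Y : D, FiniteDimensional k (X ⟶ Y)] [∀ X : D, Projective X]

lemma tracePairing_injective (X Y : D) : Function.Injective (tracePairing k X Y) := by
  rw [injective_iff_map_eq_zero]
  intro f hf
  obtain ⟨g, hg⟩ := exists_comp_comp_eq_self f
  have hgf : g ≫ f = 0 := by
    simpa using comp_eq_zero_of_compTrace_eq_zero (e := g ≫ f) (by simp [hg])
      (LinearMap.congr_fun hf g) (𝟙 X)
  rw [← hg, hgf, comp_zero]

lemma tracePairing_surjective (X Y : D) : Function.Surjective (tracePairing k X Y) := by
  have h₁ := LinearMap.finrank_le_finrank_of_injective (tracePairing_injective (k := k) X Y)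
  have h₂ := LinearMap.finrank_le_finrank_of_injective (tracePairing_injective (k := k) Y X)
  rw [Subspace.dual_finrank_eq] at h₁ h₂
  refine (LinearMap.injective_iff_surjective_of_finrank_eq_finrank ?_).1
    (tracePairing_injective X Y)
  rw [Subspace.dual_finrank_eq]
  exact le_antisymm h₁ h₂

end Perfect

/-! ### Modules as Eilenberg–Moore algebras -/

section Modules

section EssSurj

variable {B D E : Type*} [Category* B] [Category* D] [Category* E] (F : B ⥤ D) (G : D ⥤ E)

lemma essSurj_comp_equivalence_iff [G.IsEquivalence] : (F ⋙ G).EssSurj ↔ F.EssSurj :=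
  ⟨fun _ => Functor.essSurj_of_comp_fully_faithful F G, fun _ => inferInstance⟩

lemma essSurj_equivalence_comp_iff [F.IsEquivalence] : (F ⋙ G).EssSurj ↔ G.EssSurj :=
  ⟨fun h => ⟨fun Y => let ⟨X, hX⟩ := h.mem_essImage Y; ⟨F.obj X, hX⟩⟩, fun _ => inferInstance⟩

end EssSurj

section Monad

variable {D : Type u} [Category.{v} D] (T : Monad D)

lemma unit_comp_map_comp_mul {X Y : D} (f : X ⟶ T.obj Y) :
    T.η.app X ≫ T.map f ≫ T.μ.app Y = f := by
  have h : f ≫ T.η.app (T.obj Y) = T.η.app X ≫ T.map f := T.η.naturality f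
  rw [← reassoc_of% h, T.left_unit]
  exact Category.comp_id f

lemma map_unit_comp_comp_mul {X Y : D} {f : T.obj X ⟶ T.obj Y}
    (h : T.map f ≫ T.μ.app Y = T.μ.app X ≫ f) : T.map (T.η.app X ≫ f) ≫ T.μ.app Y = f := by
  rw [T.map_comp, Category.assoc, h]
  exact T.right_unit_assoc X f

instance : (kleisliComparison T).Full where
  map_surjective {Y _} f :=
    ⟨⟨T.η.app Y.of ≫ f.f⟩, Monad.Algebra.Hom.ext (map_unit_comp_comp_mul T f.h)⟩

instance : (kleisliComparison T).Faithful where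
  map_injective {Y _} f g h := Kleisli.Hom.ext <| by
    rw [← unit_comp_map_comp_mul T f.of, ← unit_comp_map_comp_mul T g.of]
    exact congrArg (T.η.app Y.of ≫ ·) (congrArg Monad.Algebra.Hom.f h)

theorem adjunctionTrivial_iff_free_essSurj : AdjunctionTrivial T ↔ T.free.EssSurj := by
  constructor
  · intro h
    have := h.essSurj
    exact ⟨fun M => ⟨_, ⟨(kleisliComparison T).objObjPreimageIso M⟩⟩⟩
  · intro h
    have : (kleisliComparison T).EssSurj :=
      ⟨fun M => ⟨Kleisli.mk T (T.free.objPreimage M), ⟨T.free.objObjPreimageIso M⟩⟩⟩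
    exact { }

end Monad

variable {C : Type u} [Category.{v} C] [MonoidalCategory C] {A : C} [MonObj A]

section LeftModules

/-- The action map of a left module. -/
def act (M : Mod C A) : A ⊗ M.X ⟶ M.X := ModObj.smul (M := A) (X := M.X)

lemma one_act (M : Mod C A) : MonObj.one (X := A) ▷ M.X ≫ act M = (λ_ M.X).hom :=
  ModObj.one_smul (M := A) M.X

lemma mul_act (M : Mod C A) :
    MonObj.mul (X := A) ▷ M.X ≫ act M = (α_ A A M.X).hom ≫ A ◁ act M ≫ act M :=
  ModObj.mul_smul (M := A) M.X

lemma act_hom {M N : Mod C A} (f : M ⟶ N) : act M ≫ f.hom = A ◁ f.hom ≫ act N :=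
  IsModHom.smul_hom (A := A) (f := f.hom)

/-- The left module with a given action map. -/
abbrev mkMod (X : C) (a : A ⊗ X ⟶ X) (one_act : MonObj.one (X := A) ▷ X ≫ a = (λ_ X).hom)
    (mul_act : MonObj.mul (X := A) ▷ X ≫ a = (α_ A A X).hom ≫ A ◁ a ≫ a) : Mod C A :=
  letI : ModObj A X := { smul := a, one_smul := one_act, mul_smul := mul_act }
  ⟨X⟩

/-- The morphism of left modules given by an equivariant morphism. -/
abbrev mkModHom {M N : Mod C A} (f : M.X ⟶ N.X) (h : act M ≫ f = A ◁ f ≫ act N) : M ⟶ N :=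
  Mod.Hom.mk' f h

variable (A) in
/-- Left `A`-modules as Eilenberg–Moore algebras of the monad `A ⊗ -`. -/
def modToAlgebra : Mod C A ⥤ (leftMonad A).Algebra where
  obj M :=
    { A := M.X
      a := act M
      unit := by
        change ((λ_ M.X).inv ≫ MonObj.one (X := A) ▷ M.X) ≫ act M = 𝟙 _
        rw [Category.assoc, one_act, Iso.inv_hom_id]
      assoc := by
        change ((α_ A A M.X).inv ≫ MonObj.mul (X := A) ▷ M.X) ≫ act M = A ◁ act M ≫ act M
        rw [Category.assoc, mul_act, Iso.inv_hom_id_assoc] }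
  map f := { f := f.hom, h := (act_hom f).symm }

instance : (modToAlgebra A).Faithful where
  map_injective h := Mod.hom_ext _ _ (congrArg Monad.Algebra.Hom.f h)

instance : (modToAlgebra A).Full where
  map_surjective f := ⟨mkModHom f.f f.h.symm, rfl⟩

instance : (modToAlgebra A).EssSurj where
  mem_essImage M :=
    ⟨mkMod M.A M.a
      (((Iso.inv_comp_eq _).1 ((Category.assoc _ _ _).symm.trans M.unit)).trans
        (Category.comp_id _))
      ((Iso.inv_comp_eq _).1 ((Category.assoc _ _ _).symm.trans M.assoc)), ⟨Iso.refl _⟩⟩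

instance : (modToAlgebra A).IsEquivalence where

theorem adjunctionTrivial_leftMonad_iff :
    AdjunctionTrivial (leftMonad A) ↔ (freeLeft A).EssSurj :=
  (adjunctionTrivial_iff_free_essSurj _).trans
    (essSurj_comp_equivalence_iff (freeLeft A) (modToAlgebra A))

instance : (Mod.forget (D := C) A).Faithful :=
  inferInstanceAs (modToAlgebra A ⋙ (leftMonad A).forget).Faithful

instance : (Mod.forget (D := C) A).ReflectsIsomorphisms :=
  inferInstanceAs (modToAlgebra A ⋙ (leftMonad A).forget).ReflectsIsomorphisms

instance : (Mod.forget (D := C) A).IsRightAdjoint :=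
  inferInstanceAs (modToAlgebra A ⋙ (leftMonad A).forget).IsRightAdjoint

instance {J : Type*} [Category* J] [HasLimitsOfShape J C] : HasLimitsOfShape J (Mod C A) :=
  have : HasLimitsOfShape J (leftMonad A).Algebra :=
    hasLimitsOfShape_of_hasLimitsOfShape_createsLimitsOfShape (leftMonad A).forget
  Adjunction.hasLimitsOfShape_of_equivalence (modToAlgebra A)

instance {J : Type*} [Category* J] [HasColimitsOfShape J C]
    [PreservesColimitsOfShape J (tensorLeft A)] : HasColimitsOfShape J (Mod C A) :=
  have : PreservesColimitsOfShape J (leftMonad A).toFunctor := ‹_›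
  have : HasColimitsOfShape J (leftMonad A).Algebra :=
    hasColimitsOfShape_of_hasColimitsOfShape_createsColimitsOfShape (leftMonad A).forget
  Adjunction.hasColimitsOfShape_of_equivalence (modToAlgebra A)

instance {J : Type*} [Category* J] [HasColimitsOfShape J C]
    [PreservesColimitsOfShape J (tensorLeft A)] :
    PreservesColimitsOfShape J (Mod.forget (D := C) A) :=
  have : PreservesColimitsOfShape J (leftMonad A).toFunctor := ‹_›
  inferInstanceAs (PreservesColimitsOfShape J (modToAlgebra A ⋙ (leftMonad A).forget))

instance mono_hom {M N : Mod C A} (f : M ⟶ N) [Mono f] : Mono f.hom :=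
  inferInstanceAs (Mono ((Mod.forget A).map f))

end LeftModules

section RightModules

namespace RightMod

variable (A) in
/-- The functor forgetting the action on a right module. -/
def forget : RightMod A ⥤ C where
  obj M := M.X
  map f := f.hom

variable (A) in
/-- Right `A`-modules as Eilenberg–Moore algebras of the monad `- ⊗ A`. -/
def toAlgebra : RightMod A ⥤ (rightMonad A).Algebra where
  obj M :=
    { A := M.X
      a := M.act
      unit := by
        change ((ρ_ M.X).inv ≫ M.X ◁ MonObj.one (X := A)) ≫ M.act = 𝟙 _
        rw [Category.assoc, M.act_one, Iso.inv_hom_id]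
      assoc := by
        change ((α_ M.X A A).hom ≫ M.X ◁ MonObj.mul (X := A)) ≫ M.act = M.act ▷ A ≫ M.act
        rw [Category.assoc, M.act_mul, Iso.hom_inv_id_assoc] }
  map f := { f := f.hom, h := f.act_hom.symm }

instance : (toAlgebra A).Faithful where
  map_injective h := RightMod.hom_ext _ _ (congrArg Monad.Algebra.Hom.f h)

instance : (toAlgebra A).Full where
  map_surjective f := ⟨⟨f.f, f.h.symm⟩, rfl⟩

instance : (toAlgebra A).EssSurj where
  mem_essImage M :=
    ⟨⟨M.A, M.a,
      ((Iso.inv_comp_eq _).1 ((Category.assoc _ _ _).symm.trans M.unit)).trans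
        (Category.comp_id _),
      (Iso.eq_inv_comp _).2 ((Category.assoc _ _ _).symm.trans M.assoc)⟩, ⟨Iso.refl _⟩⟩

instance : (toAlgebra A).IsEquivalence where

instance : (forget A).ReflectsIsomorphisms :=
  inferInstanceAs (toAlgebra A ⋙ (rightMonad A).forget).ReflectsIsomorphisms

instance : (forget A).IsRightAdjoint :=
  inferInstanceAs (toAlgebra A ⋙ (rightMonad A).forget).IsRightAdjoint

instance mono_hom {M N : RightMod A} (f : M ⟶ N) [Mono f] : Mono f.hom :=
  inferInstanceAs (Mono ((forget A).map f))

end RightMod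

theorem adjunctionTrivial_rightMonad_iff :
    AdjunctionTrivial (rightMonad A) ↔ (freeRight A).EssSurj :=
  (adjunctionTrivial_iff_free_essSurj _).trans
    (essSurj_comp_equivalence_iff (freeRight A) (RightMod.toAlgebra A))

end RightModules

theorem isLeftMonadic_iff_isLeftEssential : IsLeftMonadic A ↔ IsLeftEssential A :=
  and_congr_right' adjunctionTrivial_leftMonad_iff

theorem isRightMonadic_iff_isRightEssential : IsRightMonadic A ↔ IsRightEssential A :=
  and_congr_right' adjunctionTrivial_rightMonad_iff

end Modules

/-! ### Essential algebras with a simple module -/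

section Simplistic

section Rigid

variable {C : Type u} [Category.{v} C] [MonoidalCategory C]

instance mono_whiskerLeft [RightRigidCategory C] (X : C) {Y Z : C} (f : Y ⟶ Z) [Mono f] :
    Mono (X ◁ f) :=
  have := (tensorLeftAdjunction X Xᘁ).isRightAdjoint
  inferInstanceAs (Mono ((tensorLeft X).map f))

instance mono_whiskerRight [LeftRigidCategory C] (X : C) {Y Z : C} (f : Y ⟶ Z) [Mono f] :
    Mono (f ▷ X) :=
  have := (tensorRightAdjunction (ᘁX : C) X).isRightAdjoint
  inferInstanceAs (Mono ((tensorRight X).map f))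

variable [Abelian C] [MonoidalPreadditive C] [Simple (𝟙_ C)]

lemma mono_coevaluation {X : C} (hX : ¬ IsZero X) (Y : C) [ExactPairing X Y] : Mono (η_ X Y) := by
  refine mono_of_nonzero_from_simple fun h => hX ?_
  have hid : (λ_ X).hom ≫ (ρ_ X).inv = 0 := by
    rw [← ExactPairing.evaluation_coevaluation X Y, h, MonoidalPreadditive.zero_whiskerRight,
      zero_comp]
  have : 𝟙 X = (λ_ X).inv ≫ ((λ_ X).hom ≫ (ρ_ X).inv) ≫ (ρ_ X).hom := by simp
  rw [IsZero.iff_id_eq_zero, this, hid, zero_comp, comp_zero]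

lemma faithful_tensorRight [RightRigidCategory C] {X : C} (hX : ¬ IsZero X) :
    (tensorRight X).Faithful := by
  have hmono (Y : C) : Mono ((tensorRightAdjunction X Xᘁ).unit.app Y) := by
    have := mono_coevaluation hX Xᘁ
    have h : (tensorRightAdjunction X Xᘁ).unit.app Y =
        (ρ_ Y).inv ≫ Y ◁ η_ X Xᘁ ≫ (α_ Y X Xᘁ).inv := by
      simp [tensorRightAdjunction, tensorRightHomEquiv]
    rw [h]
    infer_instance
  exact (tensorRightAdjunction X Xᘁ).faithful_L_of_mono_unit_app

end Rigid

variable {C : Type u} [Category.{v} C] [MonoidalCategory C] {A : C} [MonObj A]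

section Kernels

variable [Preadditive C] [MonoidalPreadditive C] [HasEqualizers C]

instance : (Mod.forget (D := C) A).PreservesZeroMorphisms where
  map_zero _ _ := rfl

lemma mono_hom_of_kernel_ι_eq_zero {M N : Mod C A} {f : M ⟶ N} (h : kernel.ι f = 0) :
    Mono f.hom :=
  Preadditive.mono_of_cancel_zero _ fun g hg => by
    obtain ⟨l, rfl⟩ := KernelFork.IsLimit.lift'
      (KernelFork.mapIsLimit _ (kernelIsKernel f) (Mod.forget A)) g hg
    exact (congrArg (l ≫ ·) (congrArg Mod.Hom.hom h)).trans comp_zero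

lemma mono_hom_of_simple {M N : Mod C A} [Simple M] {f : M ⟶ N} (hf : f ≠ 0) : Mono f.hom :=
  mono_hom_of_kernel_ι_eq_zero (kernel_zero_of_nonzero_from_simple hf)

end Kernels

section TensorModFunctor

variable (A) in
/-- The functor `M ↦ M ⊗ X` on left `A`-modules. -/
def tensorModFunctor (X : C) : Mod C A ⥤ Mod C A where
  obj M := mkMod (M.X ⊗ X) ((α_ A M.X X).inv ≫ act M ▷ X)
    (by rw [associator_inv_naturality_left_assoc, ← comp_whiskerRight, one_act]; simp)
    (by rw [associator_inv_naturality_left_assoc, ← comp_whiskerRight, mul_act]; simp)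
  map {M N} f := mkModHom (f.hom ▷ X) (by
    change ((α_ A M.X X).inv ≫ act M ▷ X) ≫ f.hom ▷ X =
      A ◁ (f.hom ▷ X) ≫ (α_ A N.X X).inv ≫ act N ▷ X
    rw [Category.assoc, ← comp_whiskerRight, act_hom]
    simp)
  map_id M := Mod.hom_ext _ _ (id_whiskerRight M.X X)
  map_comp f g := Mod.hom_ext _ _ (comp_whiskerRight f.hom g.hom X)

instance (X : C) [(tensorRight X).Faithful] : (tensorModFunctor A X).Faithful :=
  have : (tensorModFunctor A X ⋙ Mod.forget A).Faithful :=
    inferInstanceAs (Mod.forget A ⋙ tensorRight X).Faithful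
  Functor.Faithful.of_comp _ (Mod.forget A)

instance (X : C) [(tensorRight X).ReflectsIsomorphisms] :
    (tensorModFunctor A X).ReflectsIsomorphisms :=
  have : (tensorModFunctor A X ⋙ Mod.forget A).ReflectsIsomorphisms :=
    inferInstanceAs (Mod.forget A ⋙ tensorRight X).ReflectsIsomorphisms
  reflectsIsomorphisms_of_comp _ (Mod.forget A)

instance [LeftRigidCategory C] (X : C) : (tensorModFunctor A X).PreservesMonomorphisms where
  preserves f _ :=
    have : Mono ((Mod.forget A).map ((tensorModFunctor A X).map f)) :=
      inferInstanceAs (Mono (f.hom ▷ X))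
    (Mod.forget A).mono_of_mono_map this

instance [Preadditive C] [MonoidalPreadditive C] (X : C) :
    (tensorModFunctor A X).PreservesZeroMorphisms where
  map_zero _ _ := Mod.hom_ext _ _ (MonoidalPreadditive.zero_whiskerRight ..)

end TensorModFunctor

instance [Preadditive C] [MonoidalPreadditive C] : (freeLeft A).PreservesZeroMorphisms where
  map_zero _ _ := Mod.hom_ext _ _ (MonoidalPreadditive.whiskerLeft_zero ..)

theorem simple_regular_of_simple [Abelian C] [MonoidalPreadditive C] [RigidCategory C]
    [Simple (𝟙_ C)] (h : (freeLeft A).EssSurj) (S : Mod C A) [Simple S] :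
    Simple (Mod.regular A) := by
  obtain ⟨X, ⟨e⟩⟩ := h.mem_essImage S
  have : Simple ((tensorModFunctor A X).obj (Mod.regular A)) := Simple.of_iso e
  have hX : ¬ IsZero X := fun hX =>
    Simple.not_isZero S (((freeLeft A).map_isZero hX).of_iso e.symm)
  have := faithful_tensorRight hX
  exact (tensorModFunctor A X).simple_of_simple_obj (Mod.regular A)

end Simplistic

/-! ### Duality between left and right modules -/

section Duality

section Transpose

variable {C : Type u} [Category.{v} C] [MonoidalCategory C] (X Y : C) [ExactPairing X Y]

/-- Morphisms into the left member of an exact pairing, as pairings `z ↦ Y ◁ z ≫ ε_ X Y`. -/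
def pairingEquivLeft (Z : C) : (Z ⟶ X) ≃ (Y ⊗ Z ⟶ 𝟙_ C) :=
  (ρ_ X).symm.homToEquiv.trans (tensorLeftHomEquiv Z X Y (𝟙_ C)).symm

/-- Morphisms into the right member of an exact pairing, as pairings `z ↦ z ▷ X ≫ ε_ X Y`. -/
def pairingEquivRight (Z : C) : (Z ⟶ Y) ≃ (Z ⊗ X ⟶ 𝟙_ C) :=
  (λ_ Y).symm.homToEquiv.trans (tensorRightHomEquiv Z X Y (𝟙_ C)).symm

variable {X Y} {Z : C}

lemma pairingEquivLeft_apply (z : Z ⟶ X) : pairingEquivLeft X Y Z z = Y ◁ z ≫ ε_ X Y := by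
  let : HasLeftDual Y := ⟨X⟩
  exact (Equiv.symm_apply_eq _).2 (tensorLeftHomEquiv_whiskerLeft_comp_evaluation (Z := Y) z).symm

lemma pairingEquivRight_apply (z : Z ⟶ Y) : pairingEquivRight X Y Z z = z ▷ X ≫ ε_ X Y := by
  let : HasRightDual X := ⟨Y⟩
  exact (Equiv.symm_apply_eq _).2 (tensorRightHomEquiv_whiskerRight_comp_evaluation (X := X) z).symm

lemma whiskerLeft_pairingEquivLeft_symm (b : Y ⊗ Z ⟶ 𝟙_ C) :
    Y ◁ (pairingEquivLeft X Y Z).symm b ≫ ε_ X Y = b := by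
  rw [← pairingEquivLeft_apply, Equiv.apply_symm_apply]

lemma pairingEquivRight_symm_whiskerRight (b : Z ⊗ X ⟶ 𝟙_ C) :
    (pairingEquivRight X Y Z).symm b ▷ X ≫ ε_ X Y = b := by
  rw [← pairingEquivRight_apply, Equiv.apply_symm_apply]

lemma whiskerLeft_evaluation_injective {z z' : Z ⟶ X}
    (h : Y ◁ z ≫ ε_ X Y = Y ◁ z' ≫ ε_ X Y) : z = z' :=
  (pairingEquivLeft X Y Z).injective (by simpa only [pairingEquivLeft_apply] using h)

lemma whiskerRight_evaluation_injective {z z' : Z ⟶ Y}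
    (h : z ▷ X ≫ ε_ X Y = z' ▷ X ≫ ε_ X Y) : z = z' :=
  (pairingEquivRight X Y Z).injective (by simpa only [pairingEquivRight_apply] using h)

lemma coevaluation_whiskerLeft_injective {z z' : Y ⟶ Z}
    (h : η_ X Y ≫ X ◁ z = η_ X Y ≫ X ◁ z') : z = z' := by
  rw [← cancel_epi (ρ_ Y).hom, ← tensorLeftHomEquiv_symm_coevaluation_comp_whiskerLeft (Y := X), h,
    tensorLeftHomEquiv_symm_coevaluation_comp_whiskerLeft]

lemma epi_of_mono_transpose [LeftRigidCategory C] {X' Y' : C} [ExactPairing X' Y'] (q : X' ⟶ X)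
    [Mono q] (i : Y ⟶ Y') (h : i ▷ X' ≫ ε_ X' Y' = Y ◁ q ≫ ε_ X Y) : Epi i := by
  let : HasRightDual X := ⟨Y⟩
  let : HasRightDual X' := ⟨Y'⟩
  obtain rfl : i = rightAdjointMate q :=
    whiskerRight_evaluation_injective (h.trans (rightAdjointMate_comp_evaluation q).symm)
  refine ⟨fun {Z} g g' hg => coevaluation_whiskerLeft_injective (X := X') ?_⟩
  have hq : η_ X Y ≫ X ◁ rightAdjointMate q = η_ X' Y' ≫ q ▷ Y' :=
    coevaluation_comp_rightAdjointMate q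
  have transpose_comp (g : Y' ⟶ Z) :
      η_ X Y ≫ X ◁ (rightAdjointMate q ≫ g) = (η_ X' Y' ≫ X' ◁ g) ≫ q ▷ Z := by
    rw [whiskerLeft_comp, reassoc_of% hq, ← whisker_exchange, Category.assoc]
  rw [← cancel_mono (q ▷ Z), ← transpose_comp, ← transpose_comp, hg]

end Transpose

variable {C : Type u} [Category.{v} C] [MonoidalCategory C] {A : C} [MonObj A]

/-- A pairing of a right module with a left module is balanced if `b (n a, m) = b (n, a m)`. -/
def Balanced (N : RightMod A) (M : Mod C A) (b : N.X ⊗ M.X ⟶ 𝟙_ C) : Prop :=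
  N.act ▷ M.X ≫ b = (α_ N.X A M.X).hom ≫ N.X ◁ act M ≫ b

namespace Balanced

lemma whiskerLeft {N : RightMod A} {M L : Mod C A} {b : N.X ⊗ L.X ⟶ 𝟙_ C} (h : Balanced N L b)
    (f : M ⟶ L) : Balanced N M (N.X ◁ f.hom ≫ b) := by
  unfold Balanced at h ⊢
  rw [← whisker_exchange_assoc, h, ← whiskerLeft_comp_assoc, act_hom]
  simp

lemma whiskerRight {N M : RightMod A} {L : Mod C A} {b : N.X ⊗ L.X ⟶ 𝟙_ C} (h : Balanced N L b)
    (f : M ⟶ N) : Balanced M L (f.hom ▷ L.X ≫ b) := by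
  unfold Balanced at h ⊢
  rw [← comp_whiskerRight_assoc, f.act_hom, comp_whiskerRight_assoc, h, whisker_exchange_assoc]
  simp

variable {N : RightMod A} {L : Mod C A} [ExactPairing L.X N.X] (h : Balanced N L (ε_ L.X N.X))
include h

/-- The morphism of left modules corresponding to a balanced pairing `b`, when `N` and `L` are
dual. -/
def leftHom {M : Mod C A} {b : N.X ⊗ M.X ⟶ 𝟙_ C} (hb : Balanced N M b) : M ⟶ L :=
  mkModHom ((pairingEquivLeft L.X N.X M.X).symm b) <| by
    refine whiskerLeft_evaluation_injective (X := L.X) (Y := N.X) ?_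
    rw [whiskerLeft_comp_assoc, whiskerLeft_pairingEquivLeft_symm, whiskerLeft_comp_assoc,
      ← (Iso.inv_comp_eq _).2 h, associator_inv_naturality_right_assoc, whisker_exchange_assoc,
      whiskerLeft_pairingEquivLeft_symm, hb, Iso.inv_hom_id_assoc]

/-- The morphism of right modules corresponding to a balanced pairing `b`, when `N` and `L` are
dual. -/
def rightHom {M : RightMod A} {b : M.X ⊗ L.X ⟶ 𝟙_ C} (hb : Balanced M L b) : M ⟶ N :=
  ⟨(pairingEquivRight L.X N.X M.X).symm b, by
    refine whiskerRight_evaluation_injective (X := L.X) (Y := N.X) ?_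
    unfold Balanced at h hb
    rw [comp_whiskerRight_assoc, pairingEquivRight_symm_whiskerRight, comp_whiskerRight_assoc, h,
      hb, associator_naturality_left_assoc, ← whisker_exchange_assoc,
      pairingEquivRight_symm_whiskerRight]⟩

lemma whiskerLeft_leftHom {M : Mod C A} {b : N.X ⊗ M.X ⟶ 𝟙_ C} (hb : Balanced N M b) :
    N.X ◁ (h.leftHom hb).hom ≫ ε_ L.X N.X = b :=
  whiskerLeft_pairingEquivLeft_symm b

lemma rightHom_whiskerRight {M : RightMod A} {b : M.X ⊗ L.X ⟶ 𝟙_ C} (hb : Balanced M L b) :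
    (h.rightHom hb).hom ▷ L.X ≫ ε_ L.X N.X = b :=
  pairingEquivRight_symm_whiskerRight b

section Mate

variable {N' : RightMod A} {L' : Mod C A} [ExactPairing L'.X N'.X]
  (h' : Balanced N' L' (ε_ L'.X N'.X))
include h'

/-- The morphism `N' ⟶ N` of right modules dual to a morphism `L ⟶ L'` of left modules. -/
def mate (f : L ⟶ L') : N' ⟶ N :=
  h.rightHom (h'.whiskerLeft f)

lemma mate_whiskerRight (f : L ⟶ L') :
    (h.mate h' f).hom ▷ L.X ≫ ε_ L.X N.X = N'.X ◁ f.hom ≫ ε_ L'.X N'.X :=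
  h.rightHom_whiskerRight _

lemma mate_comp_mate {f : L ⟶ L'} {g : L' ⟶ L} (hfg : f ≫ g = 𝟙 L) :
    h'.mate h g ≫ h.mate h' f = 𝟙 N := by
  have hfg' : f.hom ≫ g.hom = 𝟙 L.X := congrArg Mod.Hom.hom hfg
  refine RightMod.hom_ext _ _ (whiskerRight_evaluation_injective (X := L.X) ?_)
  rw [RightMod.comp_hom, comp_whiskerRight_assoc, mate_whiskerRight, ← whisker_exchange_assoc,
    mate_whiskerRight, ← whiskerLeft_comp_assoc, hfg']
  simp

/-- Duals of isomorphic left modules are isomorphic. -/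
def isoOfIso (e : L ≅ L') : N ≅ N' where
  hom := h'.mate h e.inv
  inv := h.mate h' e.hom
  hom_inv_id := h.mate_comp_mate h' e.hom_inv_id
  inv_hom_id := h'.mate_comp_mate h e.inv_hom_id

end Mate

end Balanced

section DualMod

variable (N : RightMod A) (L : C) [ExactPairing L N.X]

/-- The left module structure on a dual `L` of a right module `N`, for which the evaluation is
balanced. -/
def dualMod : Mod C A :=
  have hact : N.X ◁ (pairingEquivLeft L N.X (A ⊗ L)).symm
      ((α_ N.X A L).inv ≫ N.act ▷ L ≫ ε_ L N.X) ≫ ε_ L N.X =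
      (α_ N.X A L).inv ≫ N.act ▷ L ≫ ε_ L N.X :=
    whiskerLeft_pairingEquivLeft_symm _
  mkMod L ((pairingEquivLeft L N.X (A ⊗ L)).symm ((α_ N.X A L).inv ≫ N.act ▷ L ≫ ε_ L N.X))
    (by
      apply whiskerLeft_evaluation_injective (Y := N.X)
      rw [whiskerLeft_comp_assoc, hact, associator_inv_naturality_middle_assoc,
        ← comp_whiskerRight_assoc, N.act_one]
      simp)
    (by
      apply whiskerLeft_evaluation_injective (Y := N.X)
      rw [whiskerLeft_comp_assoc, hact, associator_inv_naturality_middle_assoc,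
        ← comp_whiskerRight_assoc, N.act_mul]
      simp only [whiskerLeft_comp, Category.assoc, hact]
      rw [associator_inv_naturality_right_assoc, whisker_exchange_assoc, hact]
      simp)

instance : ExactPairing (dualMod N L).X N.X := inferInstanceAs (ExactPairing L N.X)

lemma balanced_dualMod : Balanced N (dualMod N L) (ε_ (dualMod N L).X N.X) :=
  (Iso.inv_comp_eq _).1 (whiskerLeft_pairingEquivLeft_symm _).symm

end DualMod

theorem Balanced.simple [Abelian C] [MonoidalPreadditive C] [RigidCategory C] {N : RightMod A}
    {L : Mod C A} [ExactPairing L.X N.X] (h : Balanced N L (ε_ L.X N.X)) [Simple L] :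
    Simple N := by
  refine ⟨fun {I} i _ => ⟨?_, fun hi => ?_⟩⟩
  · rintro _ rfl
    have hN : IsZero N.X := (IsZero.iff_id_eq_zero _).2 <|
      (congrArg RightMod.Hom.hom (IsIso.inv_hom_id (0 : I ⟶ N))).symm.trans comp_zero
    exact id_nonzero L <| Mod.hom_ext _ _ <|
      whiskerLeft_evaluation_injective (X := L.X) (Y := N.X) <|
        (((tensorRight L.X).map_isZero hN).eq_of_src _ _)
  · have hI := balanced_dualMod I (ᘁI.X)
    let q : L ⟶ dualMod I (ᘁI.X) := hI.leftHom (h.whiskerRight i)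
    have hq : I.X ◁ q.hom ≫ ε_ _ _ = i.hom ▷ L.X ≫ ε_ L.X N.X := hI.whiskerLeft_leftHom _
    have hq0 : q ≠ 0 := fun h0 => hi <| RightMod.hom_ext _ _ <|
      whiskerRight_evaluation_injective (X := L.X) (Y := N.X) <| by
        have hq0 : q.hom = 0 := congrArg Mod.Hom.hom h0
        change i.hom ▷ L.X ≫ _ = (0 : I.X ⟶ N.X) ▷ L.X ≫ _
        rw [← hq, hq0]
        simp
    have : Mono q.hom := mono_hom_of_simple hq0
    have : Epi i.hom := epi_of_mono_transpose q.hom i.hom hq.symm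
    have : IsIso ((RightMod.forget A).map i) := isIso_of_mono_of_epi i.hom
    exact isIso_of_reflects_iso i (RightMod.forget A)

end Duality

/-! ### Frobenius forms -/

section Frobenius

variable {C : Type u} [Category.{v} C] [MonoidalCategory C] {A : C} [MonObj A]

section FrobeniusForms

lemma balanced_regular (φ : A ⟶ 𝟙_ C) :
    Balanced (RightMod.regular A) (Mod.regular A) (MonObj.mul (X := A) ≫ φ) :=
  MonObj.mul_assoc_assoc A φ

lemma balanced_free [ExactPairing A A] {φ : A ⟶ 𝟙_ C} (hφ : ε_ A A = MonObj.mul (X := A) ≫ φ)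
    (X Y : C) [ExactPairing X Y] :
    Balanced ((freeRight A).obj Y) ((freeLeft A).obj X) (ε_ (A ⊗ X) (Y ⊗ A)) := by
  change ((α_ Y A A).hom ≫ Y ◁ MonObj.mul (X := A)) ▷ (A ⊗ X) ≫ ε_ (A ⊗ X) (Y ⊗ A) =
    (α_ (Y ⊗ A) A (A ⊗ X)).hom ≫ (Y ⊗ A) ◁ ((α_ A A X).inv ≫ MonObj.mul (X := A) ▷ X) ≫
      ε_ (A ⊗ X) (Y ⊗ A)
  rw [ExactPairing.tensor_evaluation, hφ]
  calc _ = 𝟙 _ ⊗≫ Y ◁ (MonObj.mul (X := A) ▷ A ≫ MonObj.mul (X := A) ≫ φ) ▷ X ⊗≫ ε_ X Y := by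
        monoidal
    _ = _ := by
        rw [MonObj.mul_assoc_assoc]
        monoidal

/-- A form `φ` is a Frobenius form if the pairing `(a, b) ↦ φ (a b)` is a perfect duality of the
object `A` with itself. -/
def IsFrobeniusForm (φ : A ⟶ 𝟙_ C) : Prop :=
  ∃ _ : ExactPairing A A, ε_ A A = MonObj.mul (X := A) ≫ φ

theorem IsFrobeniusForm.freeRight_essSurj [RigidCategory C] {φ : A ⟶ 𝟙_ C}
    (hφ : IsFrobeniusForm φ) (h : (freeLeft A).EssSurj) : (freeRight A).EssSurj where
  mem_essImage N := by
    obtain ⟨_, hφ⟩ := hφ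
    obtain ⟨X, ⟨e⟩⟩ := h.mem_essImage (dualMod N (ᘁN.X))
    let : ExactPairing ((freeLeft A).obj X).X ((freeRight A).obj Xᘁ).X :=
      inferInstanceAs (ExactPairing (A ⊗ X) (Xᘁ ⊗ A))
    exact ⟨_, ⟨(balanced_free hφ X Xᘁ).isoOfIso (balanced_dualMod N (ᘁN.X)) e⟩⟩

theorem IsFrobeniusForm.simple_rightRegular [Abelian C] [MonoidalPreadditive C] [RigidCategory C]
    {φ : A ⟶ 𝟙_ C} (hφ : IsFrobeniusForm φ) [Simple (Mod.regular A)] :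
    Simple (RightMod.regular A) := by
  obtain ⟨p, hφ⟩ := hφ
  let : ExactPairing (Mod.regular A).X (RightMod.regular A).X := p
  refine Balanced.simple (N := RightMod.regular A) (L := Mod.regular A) ?_
  exact (congrArg (Balanced (RightMod.regular A) (Mod.regular A)) hφ).mpr (balanced_regular φ)

end FrobeniusForms

section Nondegenerate

variable [Preadditive C] [MonoidalPreadditive C]

/-- A linear form on a left module `A` is nondegenerate if its kernel contains no nonzero
submodule. -/
def Nondegenerate (φ : A ⟶ 𝟙_ C) : Prop :=
  ∀ (K : Mod C A) (i : K ⟶ Mod.regular A), Mono i → i.hom ≫ φ = 0 → i = 0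

lemma Nondegenerate.mono_hom [HasEqualizers C] {φ : A ⟶ 𝟙_ C} (hφ : Nondegenerate φ)
    {M : Mod C A} (f : Mod.regular A ⟶ M) {ψ : M.X ⟶ 𝟙_ C} (hψ : f.hom ≫ ψ = φ) :
    Mono f.hom := by
  refine mono_hom_of_kernel_ι_eq_zero (hφ _ _ inferInstance ?_)
  have hf : (kernel.ι f).hom ≫ f.hom = 0 := congrArg Mod.Hom.hom (kernel.condition f)
  rw [← hψ, reassoc_of% hf, zero_comp]

instance (B : C) [ExactPairing B A] : ExactPairing B (RightMod.regular A).X :=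
  inferInstanceAs (ExactPairing B A)

theorem Nondegenerate.isFrobeniusForm [HasEqualizers C] [LeftRigidCategory C] {k : Type w}
    [Field k] [Linear k C] {B : C} [ExactPairing A B] [ExactPairing B A] [Projective B]
    [FiniteDimensional k (B ⟶ A)] [FiniteDimensional k (B ⟶ B)]
    {φ : A ⟶ 𝟙_ C} (hφ : Nondegenerate φ) : IsFrobeniusForm φ := by
  let b : A ⊗ A ⟶ 𝟙_ C := MonObj.mul (X := A) ≫ φ
  let hB := balanced_dualMod (RightMod.regular A) B
  let g : A ⟶ B := (hB.leftHom (balanced_regular φ)).hom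
  have hg : A ◁ g ≫ ε_ B A = b := hB.whiskerLeft_leftHom (balanced_regular φ)
  let f : A ⟶ B := (pairingEquivRight A B A).symm b
  have hf : f ▷ A ≫ ε_ A B = b := pairingEquivRight_symm_whiskerRight b
  have : Mono g := by
    refine hφ.mono_hom (hB.leftHom (balanced_regular φ))
      (ψ := (λ_ B).inv ≫ MonObj.one (X := A) ▷ B ≫ ε_ B A) ?_
    change g ≫ (λ_ B).inv ≫ MonObj.one (X := A) ▷ B ≫ ε_ B A = φ
    rw [leftUnitor_inv_naturality_assoc, whisker_exchange_assoc, hg, MonObj.one_mul_assoc,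
      Iso.inv_hom_id_assoc]
  have : Epi f := epi_of_mono_transpose g f (hf.trans hg.symm)
  have : IsIso g := isIso_of_mono_of_epi_of_projective (k := k) g f
  exact ⟨exactPairingCongrLeft (asIso g), hg⟩

end Nondegenerate

end Frobenius

/-! ### Existence of nondegenerate forms -/

section Existence

variable {C : Type u} [Category.{v} C] [MonoidalCategory C] {A : C} [MonObj A]

lemma unit_ne_zero [Preadditive C] [MonoidalPreadditive C] (hA : ¬ IsZero A) :
    MonObj.one (X := A) ≠ 0 := fun h => hA <| (IsZero.iff_id_eq_zero A).2 <| by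
  rw [← Iso.inv_hom_id (λ_ A), ← MonObj.one_mul A, h, MonoidalPreadditive.zero_whiskerRight,
    zero_comp, comp_zero]

section Splitting

lemma projective_of_freeLeft_essSurj [HasPushouts C]
    [PreservesColimitsOfShape WalkingSpan (tensorLeft A)] [∀ X : C, Projective X]
    (h : (freeLeft A).EssSurj) (M : Mod C A) : Projective M := by
  obtain ⟨X, ⟨e⟩⟩ := h.mem_essImage M
  have : PreservesColimitsOfShape WalkingSpan (leftMonad A).toFunctor := ‹_›
  have : Projective ((modToAlgebra A).obj ((freeLeft A).obj X)) :=
    (leftMonad A).adj.map_projective X inferInstance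
  exact ((modToAlgebra A).asEquivalence.map_projective_iff M).1
    (.of_iso ((modToAlgebra A).mapIso e) this)

variable [Abelian C] [MonoidalPreadditive C]

lemma isSplitMono_of_projective_module_cokernel
    [PreservesColimitsOfShape WalkingParallelPair (tensorLeft A)]
    {K M : Mod C A} (i : K ⟶ M) [Mono i] [Projective (cokernel i)] : IsSplitMono i := by
  let p := (cokernel.π i).hom
  let s := Projective.factorThru (𝟙 (cokernel i)) (cokernel.π i)
  have hs : s.hom ≫ p = 𝟙 (cokernel i).X :=
    congrArg Mod.Hom.hom (Projective.factorThru_comp (𝟙 (cokernel i)) (cokernel.π i))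
  have hip : i.hom ≫ p = 0 := congrArg Mod.Hom.hom (cokernel.condition i)
  have hp : IsColimit (CokernelCofork.ofπ p hip) :=
    CokernelCofork.mapIsColimit _ (cokernelIsCokernel i) (Mod.forget A)
  have hi := Abelian.monoIsKernelOfCokernel _ hp
  let r : M.X ⟶ K.X := hi.lift (KernelFork.ofι (𝟙 M.X - p ≫ s.hom) (by simp [hs]))
  have hr : r ≫ i.hom = 𝟙 M.X - p ≫ s.hom := hi.fac _ WalkingParallelPair.zero
  have hir : i.hom ≫ r = 𝟙 K.X := by
    rw [← cancel_mono i.hom, Category.assoc, hr]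
    simp [reassoc_of% hip]
  have r_act : act M ≫ r = A ◁ r ≫ act K := by
    have hps : act M ≫ p ≫ s.hom = A ◁ (p ≫ s.hom) ≫ act M := act_hom (cokernel.π i ≫ s)
    have hsub : A ◁ (𝟙 M.X - p ≫ s.hom) = 𝟙 (A ⊗ M.X) - A ◁ (p ≫ s.hom) :=
      ((tensorLeft A).map_sub).trans (congrArg (· - A ◁ (p ≫ s.hom)) (whiskerLeft_id A M.X))
    rw [← cancel_mono i.hom, Category.assoc, Category.assoc, hr, act_hom, ← whiskerLeft_comp_assoc,
      hr, hsub, Preadditive.comp_sub, Preadditive.sub_comp, Category.comp_id, Category.id_comp, hps]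
  exact ⟨⟨mkModHom r r_act, Mod.hom_ext _ _ hir⟩⟩

lemma isSplitMono_of_freeLeft_essSurj [LeftRigidCategory C] [∀ X : C, Projective X]
    (h : (freeLeft A).EssSurj) {K M : Mod C A} (i : K ⟶ M) [Mono i] : IsSplitMono i := by
  have := (tensorLeftAdjunction (ᘁA : C) A).isLeftAdjoint
  have := projective_of_freeLeft_essSurj h (cokernel i)
  exact isSplitMono_of_projective_module_cokernel i

end Splitting

section Forms

variable [Abelian C] [MonoidalPreadditive C]

lemma IsLeftSimplistic.exists_nondegenerate [∀ X : C, Projective X] (h : IsLeftSimplistic A) :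
    ∃ φ : A ⟶ 𝟙_ C, Nondegenerate φ := by
  obtain ⟨hA, hs⟩ := h
  obtain ⟨φ, hφ⟩ := exists_comp_comp_eq_self (MonObj.one (X := A))
  refine ⟨φ, fun K i _ h => ?_⟩
  by_contra hi
  have := isIso_of_mono_of_nonzero hi
  have h0 : φ = 0 :=
    (cancel_epi ((Mod.forget A).map i)).1 (h.trans comp_zero.symm)
  apply unit_ne_zero hA
  rw [← hφ, h0, zero_comp, comp_zero]

variable {k : Type w} [Field k] [Linear k C] [MonoidalLinear k C]

variable (A k) in
/-- Right multiplication by an element `u : 𝟙_ C ⟶ A`, as an endomorphism of the object `A`. -/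
def rightMul : (𝟙_ C ⟶ A) →ₗ[k] (A ⟶ A) where
  toFun u := (ρ_ A).inv ≫ A ◁ u ≫ MonObj.mul (X := A)
  map_add' u v := by simp
  map_smul' r u := by simp

lemma rightMul_one_comp {e : A ⟶ A}
    (he : MonObj.mul (X := A) ≫ e = A ◁ e ≫ MonObj.mul (X := A)) :
    rightMul A k (MonObj.one (X := A) ≫ e) = e := by
  change (ρ_ A).inv ≫ A ◁ (MonObj.one (X := A) ≫ e) ≫ MonObj.mul (X := A) = e
  rw [whiskerLeft_comp_assoc, ← he, MonObj.mul_one_assoc, Iso.inv_hom_id_assoc]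

theorem exists_nondegenerate_of_freeLeft_essSurj [LeftRigidCategory C]
    [∀ X : C, Projective X] [CharZero k] [∀ X Y : C, FiniteDimensional k (X ⟶ Y)]
    (h : (freeLeft A).EssSurj) : ∃ φ : A ⟶ 𝟙_ C, Nondegenerate φ := by
  obtain ⟨φ, hφ⟩ := tracePairing_surjective (k := k) (𝟙_ C) A
    (compTrace k (𝟙_ C) A ∘ₗ rightMul A k)
  refine ⟨φ, fun K i _ hi => ?_⟩
  have := isSplitMono_of_freeLeft_essSurj h i
  let r : A ⟶ K.X := (retraction i).hom
  let j : K.X ⟶ A := i.hom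
  have hjφ : j ≫ φ = 0 := hi
  have hjr : j ≫ r = 𝟙 K.X := congrArg Mod.Hom.hom (IsSplitMono.id i)
  have he := rightMul_one_comp (k := k) (e := r ≫ j) (act_hom (retraction i ≫ i))
  have htr : compTrace k (𝟙_ C) A (r ≫ j) = 0 := by
    have hφe := LinearMap.congr_fun hφ (MonObj.one (X := A) ≫ r ≫ j)
    rw [tracePairing_apply, Category.assoc, Category.assoc, hjφ, comp_zero, comp_zero, map_zero,
      LinearMap.comp_apply, he] at hφe
    exact hφe.symm
  have hrj : r ≫ j = 0 := by
    rw [← he, comp_eq_zero_of_compTrace_eq_zero (by simp [reassoc_of% hjr]) htr, map_zero]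
  have hj : j = 0 := by rw [← Category.id_comp j, ← hjr, Category.assoc, hrj, comp_zero]
  exact Mod.hom_ext _ _ hj

end Forms

end Existence

/-! ### The reversed monoidal category -/

section Reverse

open MonoidalOpposite

variable {C : Type u} [Category.{v} C]

/-- The bijection between the morphisms of the reversed category and those of the category. -/
def unmopHomEquiv (X Y : Cᴹᵒᵖ) : (X ⟶ Y) ≃ (unmop X ⟶ unmop Y) where
  toFun f := f.unmop
  invFun f := f.mop

instance : (mopFunctor C).IsEquivalence :=
  inferInstanceAs (mopEquiv C).functor.IsEquivalence

instance : (unmopFunctor C).IsEquivalence :=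
  inferInstanceAs (unmopEquiv C).functor.IsEquivalence

section Preadditive

variable [Preadditive C]

instance : Preadditive Cᴹᵒᵖ where
  homGroup X Y := (unmopHomEquiv X Y).addCommGroup
  add_comp _ _ _ f f' g :=
    Quiver.Hom.unmop_inj (Preadditive.add_comp _ _ _ f.unmop f'.unmop g.unmop)
  comp_add _ _ _ f g g' :=
    Quiver.Hom.unmop_inj (Preadditive.comp_add _ _ _ f.unmop g.unmop g'.unmop)

instance {k : Type w} [Field k] [Linear k C] : Linear k Cᴹᵒᵖ where
  homModule X Y := (unmopHomEquiv X Y).module k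
  smul_comp _ _ _ r f g := Quiver.Hom.unmop_inj (Linear.smul_comp _ _ _ r f.unmop g.unmop)
  comp_smul _ _ _ f r g := Quiver.Hom.unmop_inj (Linear.comp_smul _ _ _ f.unmop r g.unmop)

instance {k : Type w} [Field k] [Linear k C]
    [∀ X Y : C, FiniteDimensional k (X ⟶ Y)] (X Y : Cᴹᵒᵖ) : FiniteDimensional k (X ⟶ Y) :=
  Module.Finite.equiv (M := unmop X ⟶ unmop Y)
    { (unmopHomEquiv X Y).symm with
      map_add' := fun _ _ => rfl
      map_smul' := fun _ _ => rfl }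

end Preadditive

noncomputable instance [Abelian C] : Abelian Cᴹᵒᵖ :=
  have : HasFiniteProducts Cᴹᵒᵖ :=
    ⟨fun _ => Adjunction.hasLimitsOfShape_of_equivalence (unmopFunctor C)⟩
  abelianOfEquivalence (unmopFunctor C)

instance [∀ X : C, Projective X] (X : Cᴹᵒᵖ) : Projective X :=
  ((unmopEquiv C).map_projective_iff X).1 inferInstance

lemma isZero_mop_iff (X : C) : IsZero (mop X) ↔ IsZero X :=
  ⟨fun h => IsZero.of_full_of_faithful_of_isZero (mopFunctor C) X h,
    fun h => IsZero.of_full_of_faithful_of_isZero (unmopFunctor C) (mop X) h⟩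

variable [MonoidalCategory C]

instance [Preadditive C] [MonoidalPreadditive C] :
    MonoidalPreadditive Cᴹᵒᵖ where
  whiskerLeft_zero {X _ _} :=
    Quiver.Hom.unmop_inj (MonoidalPreadditive.zero_whiskerRight (X := unmop X))
  zero_whiskerRight {X _ _} :=
    Quiver.Hom.unmop_inj (MonoidalPreadditive.whiskerLeft_zero (X := unmop X))
  whiskerLeft_add f g :=
    Quiver.Hom.unmop_inj (MonoidalPreadditive.add_whiskerRight f.unmop g.unmop)
  add_whiskerRight f g :=
    Quiver.Hom.unmop_inj (MonoidalPreadditive.whiskerLeft_add f.unmop g.unmop)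

instance {k : Type w} [Field k] [Preadditive C] [MonoidalPreadditive C]
    [Linear k C] [MonoidalLinear k C] : MonoidalLinear k Cᴹᵒᵖ where
  whiskerLeft_smul X _ _ r f :=
    Quiver.Hom.unmop_inj (MonoidalLinear.smul_whiskerRight r f.unmop (unmop X))
  smul_whiskerRight r _ _ f X :=
    Quiver.Hom.unmop_inj (MonoidalLinear.whiskerLeft_smul (unmop X) r f.unmop)

/-- An exact pairing becomes an exact pairing in the opposite order in the reversed category. -/
@[reducible]
def exactPairingMop (X Y : C) [ExactPairing X Y] : ExactPairing (mop Y) (mop X) where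
  coevaluation' := (η_ X Y).mop
  evaluation' := (ε_ X Y).mop
  coevaluation_evaluation' := Quiver.Hom.unmop_inj (ExactPairing.evaluation_coevaluation X Y)
  evaluation_coevaluation' := Quiver.Hom.unmop_inj (ExactPairing.coevaluation_evaluation X Y)

instance [RigidCategory C] : RigidCategory Cᴹᵒᵖ where
  rightDual X :=
    { rightDual := mop (HasLeftDual.leftDual (unmop X))
      exact := exactPairingMop (HasLeftDual.leftDual (unmop X)) (unmop X) }
  leftDual X :=
    { leftDual := mop (HasRightDual.rightDual (unmop X))
      exact := exactPairingMop (unmop X) (HasRightDual.rightDual (unmop X)) }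

instance [Preadditive C] [Simple (𝟙_ C)] : Simple (𝟙_ Cᴹᵒᵖ) :=
  have : Simple ((unmopFunctor C).obj (𝟙_ Cᴹᵒᵖ)) := inferInstanceAs (Simple (𝟙_ C))
  (simple_obj_iff (unmopFunctor C) (𝟙_ Cᴹᵒᵖ)).1 this

variable (A : C) [MonObj A]

/-- Left modules in the reversed category are right modules. -/
def leftModMop : Mod Cᴹᵒᵖ (mop A) ⥤ RightMod A where
  obj M :=
    { X := unmop M.X
      act := (act M).unmop
      act_one := congrArg Quiver.Hom.unmop (one_act M)
      act_mul := congrArg Quiver.Hom.unmop (mul_act M) }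
  map f :=
    { hom := f.hom.unmop
      act_hom := congrArg Quiver.Hom.unmop (act_hom f) }

instance : (leftModMop A).Faithful where
  map_injective h := Mod.hom_ext _ _ (Quiver.Hom.unmop_inj (congrArg RightMod.Hom.hom h))

instance : (leftModMop A).Full where
  map_surjective f := ⟨mkModHom f.hom.mop (Quiver.Hom.unmop_inj f.act_hom), rfl⟩

instance : (leftModMop A).EssSurj where
  mem_essImage N := ⟨mkMod (mop N.X) N.act.mop (Quiver.Hom.unmop_inj N.act_one)
    (Quiver.Hom.unmop_inj N.act_mul), ⟨Iso.refl _⟩⟩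

instance : (leftModMop A).IsEquivalence where

/-- Right modules in the reversed category are left modules. -/
def rightModMop : RightMod (mop A) ⥤ Mod C A where
  obj N := mkMod (unmop N.X) N.act.unmop (congrArg Quiver.Hom.unmop N.act_one)
    (congrArg Quiver.Hom.unmop N.act_mul)
  map f := mkModHom f.hom.unmop (congrArg Quiver.Hom.unmop f.act_hom)

instance : (rightModMop A).Faithful where
  map_injective h := RightMod.hom_ext _ _ (Quiver.Hom.unmop_inj (congrArg Mod.Hom.hom h))

instance : (rightModMop A).Full where
  map_surjective f := ⟨⟨f.hom.mop, Quiver.Hom.unmop_inj (act_hom f)⟩, rfl⟩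

instance : (rightModMop A).EssSurj where
  mem_essImage M :=
    ⟨{ X := mop M.X
       act := (act M).mop
       act_one := Quiver.Hom.unmop_inj (one_act M)
       act_mul := Quiver.Hom.unmop_inj (mul_act M) }, ⟨Iso.refl _⟩⟩

instance : (rightModMop A).IsEquivalence where

lemma freeLeft_mop_essSurj_iff : (freeLeft (mop A)).EssSurj ↔ (freeRight A).EssSurj :=
  (essSurj_comp_equivalence_iff _ (leftModMop A)).symm.trans
    (essSurj_equivalence_comp_iff (unmopFunctor C) (freeRight A))

lemma freeRight_mop_essSurj_iff : (freeRight (mop A)).EssSurj ↔ (freeLeft A).EssSurj :=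
  (essSurj_comp_equivalence_iff _ (rightModMop A)).symm.trans
    (essSurj_equivalence_comp_iff (unmopFunctor C) (freeLeft A))

lemma isLeftEssential_mop_iff : IsLeftEssential (mop A) ↔ IsRightEssential A :=
  and_congr (not_congr (isZero_mop_iff A)) (freeLeft_mop_essSurj_iff A)

lemma isRightEssential_mop_iff : IsRightEssential (mop A) ↔ IsLeftEssential A :=
  and_congr (not_congr (isZero_mop_iff A)) (freeRight_mop_essSurj_iff A)

variable [Preadditive C] [MonoidalPreadditive C]

lemma isLeftSimplistic_mop_iff : IsLeftSimplistic (mop A) ↔ IsRightSimplistic A :=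
  and_congr (not_congr (isZero_mop_iff A))
    (simple_obj_iff (leftModMop A) (Mod.regular (mop A))).symm

lemma isRightSimplistic_mop_iff : IsRightSimplistic (mop A) ↔ IsLeftSimplistic A :=
  and_congr (not_congr (isZero_mop_iff A))
    (simple_obj_iff (rightModMop A) (RightMod.regular (mop A))).symm

lemma exists_simple_mop (h : ∃ S : RightMod A, Simple S) : ∃ S : Mod Cᴹᵒᵖ (mop A), Simple S := by
  obtain ⟨S, hS⟩ := h
  have := Simple.of_iso ((leftModMop A).objObjPreimageIso S)
  exact ⟨_, (simple_obj_iff (leftModMop A) _).1 this⟩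

end Reverse

/-! ### Exchanging left and right -/

section LeftRight

variable {C : Type u} [Category.{v} C] [Abelian C] [MonoidalCategory C] [MonoidalPreadditive C]
  {A : C} [MonObj A] [RigidCategory C]

theorem IsLeftEssential.isLeftSimplistic [Simple (𝟙_ C)] (h : IsLeftEssential A)
    (hS : ∃ S : Mod C A, Simple S) : IsLeftSimplistic A :=
  let ⟨S, _⟩ := hS
  ⟨h.1, simple_regular_of_simple h.2 S⟩

theorem IsRightEssential.isRightSimplistic [Simple (𝟙_ C)] (h : IsRightEssential A)
    (hS : ∃ S : RightMod A, Simple S) : IsRightSimplistic A :=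
  (isLeftSimplistic_mop_iff A).1
    (((isLeftEssential_mop_iff A).2 h).isLeftSimplistic (exists_simple_mop A hS))

variable [∀ X : C, Projective X] (k : Type w) [Field k] [Linear k C]
  [∀ X Y : C, FiniteDimensional k (X ⟶ Y)] (B : C) [ExactPairing A B] [ExactPairing B A]

include k B

theorem IsLeftSimplistic.isRightSimplistic (h : IsLeftSimplistic A) : IsRightSimplistic A := by
  obtain ⟨φ, hφ⟩ := h.exists_nondegenerate
  have := h.2
  exact ⟨h.1, (hφ.isFrobeniusForm (k := k) (B := B)).simple_rightRegular⟩

theorem isLeftSimplistic_iff_isRightSimplistic : IsLeftSimplistic A ↔ IsRightSimplistic A := by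
  refine ⟨fun h => h.isRightSimplistic k B, fun h => ?_⟩
  let := exactPairingMop A B
  let := exactPairingMop B A
  exact (isRightSimplistic_mop_iff A).1
    (((isLeftSimplistic_mop_iff A).2 h).isRightSimplistic k (.mop B))

variable [CharZero k] [MonoidalLinear k C]

theorem IsLeftEssential.isRightEssential (h : IsLeftEssential A) : IsRightEssential A := by
  obtain ⟨φ, hφ⟩ := exists_nondegenerate_of_freeLeft_essSurj (k := k) h.2
  exact ⟨h.1, (hφ.isFrobeniusForm (k := k) (B := B)).freeRight_essSurj h.2⟩

theorem isLeftEssential_iff_isRightEssential : IsLeftEssential A ↔ IsRightEssential A := by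
  refine ⟨fun h => h.isRightEssential k B, fun h => ?_⟩
  let := exactPairingMop A B
  let := exactPairingMop B A
  exact (isRightEssential_mop_iff A).1
    (((isLeftEssential_mop_iff A).2 h).isRightEssential k (.mop B))

end LeftRight

/-- In a pivotal category the dual of an object is also its dual on the other side. -/
@[reducible]
def PivotalStructure.dualPairing {C : Type u} [Category.{v} C] [MonoidalCategory C]
    [RigidCategory C] (p : PivotalStructure C) (X : C) : ExactPairing (dual X) X :=
  letI := DivAlg.dualPairing (dual X)
  exactPairingCongrRight (p.iso X)

end DivAlg

theorem theorem1p3_general {C : Type u} [Category.{v} C] [Abelian C] [MonoidalCategory C]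
    [MonoidalPreadditive C] (A : C) [MonObj A] :
    ((DivAlg.IsLeftMonadic A ↔ DivAlg.IsLeftEssential A) ∧
      (DivAlg.IsRightMonadic A ↔ DivAlg.IsRightEssential A)) ∧
    (∀ [RigidCategory C] [Simple (𝟙_ C)],
      ((∃ S : Mod C A, Simple S) → DivAlg.IsLeftEssential A → DivAlg.IsLeftSimplistic A) ∧
      ((∃ S : DivAlg.RightMod A, Simple S) →
        DivAlg.IsRightEssential A → DivAlg.IsRightSimplistic A)) ∧
    (∀ (k : Type w) [Field k] [Linear k C] [RigidCategory C]
      [∀ X Y : C, FiniteDimensional k (X ⟶ Y)] [∀ X : C, Projective X]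
      (B : C) [ExactPairing A B] [ExactPairing B A],
      (DivAlg.IsLeftSimplistic A ↔ DivAlg.IsRightSimplistic A) ∧
      (∀ [CharZero k] [MonoidalLinear k C],
        (DivAlg.IsLeftMonadic A ↔ DivAlg.IsRightMonadic A) ∧
        (DivAlg.IsLeftEssential A ↔ DivAlg.IsRightEssential A))) := by
  refine ⟨⟨DivAlg.isLeftMonadic_iff_isLeftEssential, DivAlg.isRightMonadic_iff_isRightEssential⟩,
    ⟨fun hS h => h.isLeftSimplistic hS, fun hS h => h.isRightSimplistic hS⟩, ?_⟩
  intro k _ _ _ _ _ B _ _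
  refine ⟨DivAlg.isLeftSimplistic_iff_isRightSimplistic k B, fun {_} {_} => ?_⟩
  rw [DivAlg.isLeftMonadic_iff_isLeftEssential, DivAlg.isRightMonadic_iff_isRightEssential]
  exact (and_self_iff).2 (DivAlg.isLeftEssential_iff_isRightEssential k B)

theorem theorem1p3 {C : Type u} [Category.{v} C] [Abelian C] [MonoidalCategory C]
    [MonoidalPreadditive C] (A : C) [MonObj A] (hA : ¬ IsZero A) :
    -- (i) monadic is equivalent to essential
    ((DivAlg.IsLeftMonadic A ↔ DivAlg.IsLeftEssential A) ∧
      (DivAlg.IsRightMonadic A ↔ DivAlg.IsRightEssential A)) ∧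
    -- (ii) essential implies simplistic
    (∀ [RigidCategory C] [Simple (𝟙_ C)],
      ((∃ S : Mod C A, Simple S) → DivAlg.IsLeftEssential A → DivAlg.IsLeftSimplistic A) ∧
      ((∃ S : DivAlg.RightMod A, Simple S) →
        DivAlg.IsRightEssential A → DivAlg.IsRightSimplistic A)) ∧
    -- (iii) left is equivalent to right
    (∀ (k : Type w) [Field k] [IsAlgClosed k] [CharZero k] [Linear k C] [MonoidalLinear k C]
      [RigidCategory C], DivAlg.IsMultifusion k C → Nonempty (DivAlg.PivotalStructure C) →
      ((DivAlg.IsLeftMonadic A ↔ DivAlg.IsRightMonadic A) ∧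
        (DivAlg.IsLeftEssential A ↔ DivAlg.IsRightEssential A) ∧
        (DivAlg.IsLeftSimplistic A ↔ DivAlg.IsRightSimplistic A))) := by
  obtain ⟨monadic_iff, essential_simplistic, left_iff_right⟩ := theorem1p3_general.{w} A
  refine ⟨monadic_iff, essential_simplistic, fun k _ _ _ _ _ _ hC ⟨p⟩ => ?_⟩
  have := hC.semisimple.projective
  have := hC.finite.finite_hom
  let := DivAlg.dualPairing A
  let := p.dualPairing A
  obtain ⟨simplistic, monadic_essential⟩ := left_iff_right k (DivAlg.dual A)
  exact ⟨monadic_essential.1, monadic_essential.2, simplistic⟩
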